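/- For a permutation $w\in S_n$ and $k\ge 2$, a $k$-descent of $w$ starts at the index $i$ if $1\le i\le n-k+1$ and $w(i)>w(i+1)>\cdots>w(i+k-1)$. Let $f_k(n)$ be the number of $w\in S_n$ that have no $k$-descent, and let $f_k(m,n)$ be the number of those with $w(1)=m$. Theorem. For each integer $k\ge 3$ there is a real number $r_k>0$ with the following properties. (a) $r_k$ is the growth constant of $f_k(n)$: there are real constants $c_k>0$ and $0\le\gamma_k<1$ such that, for all $n\ge 1$, $$f_k(n)=n!\,c_k\,r_k^{\,n}\left(1+O_k(\gamma_k^{\,n})\right).$$ (b) For all integers $1\le m\le n$, $$\frac{n f_k(m,n)}{f_k(n)}=\varphi_k\left(\frac{m}{n}\right)\left(1+O_k\left(n^{-0.49}\right)\right),$$ where the implied constant depends only on $k$, and $$\varphi_k(x)=\frac{1}{r_k}\left(1+\sum_{j=1}^{\infty}\left(-\frac{(x/r_k)^{jk-1}}{(jk-1)!}+\frac{(x/r_k)^{jk}}{(jk)!}\right)\right)=\frac{1}{r_k}\left(1-\frac{(x/r_k)^{k-1}}{(k-1)!}+\frac{(x/r_k)^{k}}{k!}-\frac{(x/r_k)^{2k-1}}{(2k-1)!}+\frac{(x/r_k)^{2k}}{(2k)!}-\cdots\right).$$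 (c) Consequently, $\varphi_k$ is the density of the limiting distribution of the first entry: for every $x\in[0,1]$, $$\lim_{n\to\infty}\frac{1}{f_k(n)}\sum_{1\le m\le xn} f_k(m,n)=\int_0^x\varphi_k(t)\,dt .$$ -/

import Mathlib

/-- `D_k(w)`, the set of starting points of the `k`-descents of `w ∈ S_n`: the (1-based) indices `i`
with `i + k - 1 ≤ n` and `w(i) > w(i+1) > ⋯ > w(i+k-1)`. The group `S_n` is `Equiv.Perm (Fin n)`;
positions and values in `Fin n` are 0-based, so that the index `i` is the position `a` with
`i = a + 1`. -/
def kDescentSet (k : ℕ) {n : ℕ} (w : Equiv.Perm (Fin n)) : Set ℕ :=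
  {i | ∃ a : Fin n, i = (a : ℕ) + 1 ∧ (a : ℕ) + k ≤ n ∧
    ∀ b c : Fin n, a ≤ b → b < c → (c : ℕ) < (a : ℕ) + k → w c < w b}

/-- The `k`-descent function `d_k(I, n)`: the number of `w ∈ S_n` with `D_k(w) = I`. -/
noncomputable def descentCount (k : ℕ) (I : Set ℕ) (n : ℕ) : ℕ :=
  Nat.card {w : Equiv.Perm (Fin n) // kDescentSet k w = I}

/-- The parametrized `k`-descent function `d_k(I, m, n)`: the number of `w ∈ S_n` with `D_k(w) = I`
and first entry `w(1) = m` (in 1-based notation). -/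
noncomputable def descentCountFirst (k : ℕ) (I : Set ℕ) (m n : ℕ) : ℕ :=
  Nat.card {w : Equiv.Perm (Fin n) //
    kDescentSet k w = I ∧ ∃ h : 0 < n, ((w ⟨0, h⟩ : Fin n) : ℕ) + 1 = m}

/-- `f_k(n)`, the number of permutations in `S_n` without `k`-descents. -/
noncomputable def avoidCount (k n : ℕ) : ℕ := descentCount k ∅ n

/-- `f_k(m, n)`, the number of permutations in `S_n` without `k`-descents and with first entry
`m`. -/
noncomputable def avoidCountFirst (k m n : ℕ) : ℕ := descentCountFirst k ∅ m n

/-- `r` is the growth constant of the numbers `f_k(n)`: there are `c > 0` and `0 ≤ γ < 1` with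
`f_k(n) = n! c r^n (1 + O(γ^n))` for all `n ≥ 1`. -/
def IsGrowthConstant (k : ℕ) (r : ℝ) : Prop :=
  0 < r ∧ ∃ c γ K : ℝ, 0 < c ∧ 0 ≤ γ ∧ γ < 1 ∧ ∀ n : ℕ, 1 ≤ n →
    ∃ E : ℝ, |E| ≤ K * γ ^ n ∧
      (avoidCount k n : ℝ) = (n.factorial : ℝ) * c * r ^ n * (1 + E)

/-- The signs of the series below: `1` at the multiples of `k` (including `0`), `-1` at the numbers
`jk - 1`, and `0` elsewhere. -/
def seriesSign (k l : ℕ) : ℝ :=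
  if k ∣ l then 1 else if k ∣ l + 1 then -1 else 0

/-- `φ_k(x) = (1/r) (1 - (x/r)^(k-1)/(k-1)! + (x/r)^k/k! - (x/r)^(2k-1)/(2k-1)! + ⋯)`,
with `r` in the place of `r_k`. -/
noncomputable def firstEntryDensity (k : ℕ) (r x : ℝ) : ℝ :=
  (1 / r) * ∑' l : ℕ, seriesSign k l * ((x / r) ^ l / (l.factorial : ℝ))

/-- The series in `firstEntryDensity` converges (absolutely) for all arguments. -/
theorem summable_firstEntryDensity (k : ℕ) (r x : ℝ) :
    Summable fun l : ℕ => seriesSign k l * ((x / r) ^ l / (l.factorial : ℝ)) := by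
  refine Summable.of_norm_bounded (Real.summable_pow_div_factorial (x / r)).norm fun l => ?_
  rw [norm_mul]
  refine mul_le_of_le_one_left (norm_nonneg _) ?_
  unfold seriesSign
  split_ifs <;> simp

/-!
Write `f n = avoidCount k n`, let `e l = seriesSign k l`, and let `f (m, n)` count the permutations
in question with first entry `m`.

The starting point is an exact formula, `f (m + 1, n + 1) = ∑ l ≤ m, e l * (m choose l) * f (n - l)`
(`avoidCountFirst_eq_sum`). It is an inclusion-exclusion over the length `l + 1` of a decreasing
start that is followed by a permutation without `k`-descents. It is proved by induction on `n`:
removal of the first entry gives a recursion for the permutations that also avoid a decreasing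
start of `p ≤ k` entries (`avoidFromCount_succ`), and the signs of the expansions for the different
`p` satisfy the matching recursion `runSign_succ_succ`.

Summation over the first entry shows that the exponential generating function of `f` is `1 / D(z)`
with `D(z) = 1 - z + z ^ k / k! - z ^ (k + 1) / (k + 1)! + ⋯`. The entire function `D` is positive
at `0` and negative at `5 / 4`, so it has a zero `ρ` in between, and `r = 1 / ρ`. No information on
the complex zeros of `D` is used: the quotient `Q(z) = D(z) / (1 - z / ρ)` is so close to `1`, in
the sum of the absolute values of its coefficients weighted by powers of `5 / 4`, that `1 / Q` has
coefficients `O((4 / 5) ^ n)` (`exists_abs_mul_pow_sub_le`). This works for all `k ≥ 3` because the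
sum `∑ (i - 1) (5 / 4) ^ i / i!` over the `i` that occur in `D` is less than `1`
(`tsum_denomCoeff_lt_one`). Hence `f n / n! = c r ^ n (1 + O((4 ρ / 5) ^ n))`.

With these asymptotics the exact formula for `n f (m, n) / f n` becomes, term by term, the series
for the density at `m / n`, up to an error `O(1 / n)` that is uniform in `m`
(`exists_abs_sub_firstEntryDensity_le`). The density is bounded below on `[0, 1]`
(`one_tenth_le_tsum`), so the relative error is `O(1 / n)` as well, which is stronger than the
exponent `-0.49` requires. The limiting distribution follows by comparing Riemann sums of the
Lipschitz function `firstEntryDensity` with its integral.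
-/

/-! ### Counting permutations by first entry -/

/-- The `p` entries `w (a), …, w (a + p - 1)` (0-based positions) exist and are decreasing. -/
def DescRun {n : ℕ} (w : Equiv.Perm (Fin n)) (a p : ℕ) : Prop :=
  a + p ≤ n ∧ ∀ b c : Fin n, a ≤ (b : ℕ) → b < c → (c : ℕ) < a + p → w c < w b

/-- `w` has no `k`-descent and does not begin with `p` decreasing entries. For `p = k` the second
condition is redundant; for `p < k` it says that `w` stays free of `k`-descents when it is preceded
by `k - p` further entries that decrease down to a value above `w (0)`. -/
def AvoidsFrom (k p : ℕ) {n : ℕ} (w : Equiv.Perm (Fin n)) : Prop :=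
  ¬ DescRun w 0 p ∧ ∀ a, ¬ DescRun w a k

lemma kDescentSet_eq_empty_iff {k : ℕ} (hk : 0 < k) {n : ℕ} (w : Equiv.Perm (Fin n)) :
    kDescentSet k w = ∅ ↔ AvoidsFrom k k w := by
  have key : kDescentSet k w = ∅ ↔ ∀ a, ¬ DescRun w a k := by
    rw [Set.eq_empty_iff_forall_notMem]
    constructor
    · rintro h a ⟨h1, h2⟩
      exact h (a + 1) ⟨⟨a, by omega⟩, rfl, h1, fun b c hb => h2 b c hb⟩
    · rintro h i ⟨a, -, h1, h2⟩
      exact h a ⟨h1, fun b c hb => h2 b c hb⟩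
  rw [key]
  exact ⟨fun h => ⟨h 0, h⟩, fun h => h.2⟩

/-- The permutation of `Fin (n + 1)` with first entry `m` whose remaining entries are in the same
relative order as those of `w`. -/
def consPerm {n : ℕ} (m : Fin (n + 1)) (w : Equiv.Perm (Fin n)) : Equiv.Perm (Fin (n + 1)) :=
  (finSuccEquiv n).trans ((Equiv.optionCongr w).trans (finSuccEquiv' m).symm)

@[simp] lemma consPerm_zero {n : ℕ} (m : Fin (n + 1)) (w : Equiv.Perm (Fin n)) :
    consPerm m w 0 = m := by
  simp [consPerm]

@[simp] lemma consPerm_succ {n : ℕ} (m : Fin (n + 1)) (w : Equiv.Perm (Fin n)) (i : Fin n) :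
    consPerm m w i.succ = m.succAbove (w i) := by
  simp [consPerm]

lemma consPerm_injective {n : ℕ} (m : Fin (n + 1)) :
    Function.Injective (consPerm m) := by
  intro w w' h
  ext i
  have := congrArg (fun v => v i.succ) h
  simp only [consPerm_succ] at this
  rw [Fin.succAbove_right_injective this]

lemma exists_consPerm {n : ℕ} (v : Equiv.Perm (Fin (n + 1))) :
    ∃ w, consPerm (v 0) w = v := by
  have hne : ∀ i : Fin n, v i.succ ≠ v 0 := fun i h => Fin.succ_ne_zero i (v.injective h)
  choose g hg using fun i => Fin.exists_succAbove_eq (hne i)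
  have ginj : Function.Injective g := by
    intro i j hij
    have : v i.succ = v j.succ := by rw [← hg, ← hg, hij]
    exact Fin.succ_injective _ (v.injective this)
  refine ⟨Equiv.ofBijective g (Finite.injective_iff_bijective.1 ginj), ?_⟩
  ext i
  refine Fin.cases ?_ (fun i => ?_) i
  · simp
  · rw [consPerm_succ]; simp [hg]

lemma descRun_consPerm_succ {n : ℕ} (m : Fin (n + 1)) (w : Equiv.Perm (Fin n)) (a p : ℕ) :
    DescRun (consPerm m w) (a + 1) p ↔ DescRun w a p := by
  constructor
  · rintro ⟨h1, h2⟩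
    refine ⟨by omega, fun b c hb hbc hc => ?_⟩
    have := h2 b.succ c.succ (by simp; omega) (by simpa using hbc) (by simp; omega)
    simpa using this
  · rintro ⟨h1, h2⟩
    refine ⟨by omega, fun b c => ?_⟩
    refine Fin.cases (fun hb => by simp at hb) (fun b => ?_) b
    refine Fin.cases (fun _ hb => by simp at hb) (fun c hb hbc hc => ?_) c
    simp only [consPerm_succ, Fin.succAbove_lt_succAbove_iff]
    exact h2 b c (by simpa using hb) (by simpa using hbc) (by simp at hc; omega)

lemma descRun_consPerm_zero {n : ℕ} (m : Fin (n + 2)) (w : Equiv.Perm (Fin (n + 1))) (p : ℕ)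
    (hp : 0 < p) :
    DescRun (consPerm m w) 0 (p + 1) ↔ (w 0).castSucc < m ∧ DescRun w 0 p := by
  constructor
  · rintro ⟨h1, h2⟩
    refine ⟨?_, by omega, fun b c hb hbc hc => ?_⟩
    · have := h2 0 (Fin.succ 0) (by simp) (by simp) (by simp; omega)
      rwa [consPerm_zero, consPerm_succ, Fin.succAbove_lt_iff_castSucc_lt] at this
    · have := h2 b.succ c.succ (by simp) (by simpa using hbc) (by simp; omega)
      simpa using this
  · rintro ⟨h0, h1, h2⟩
    refine ⟨by omega, fun b c => ?_⟩
    refine Fin.cases (fun _ hb => by simp at hb) (fun c => ?_) c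
    refine Fin.cases (fun _ _ hc => ?_) (fun b _ hbc hc => ?_) b
    · rw [consPerm_zero, consPerm_succ, Fin.succAbove_lt_iff_castSucc_lt]
      refine lt_of_le_of_lt ?_ h0
      rw [Fin.castSucc_le_castSucc_iff]
      rcases eq_or_ne c 0 with rfl | hc0
      · exact le_rfl
      · exact (h2 0 c (by simp) (Fin.pos_iff_ne_zero.2 hc0) (by simp at hc; omega)).le
    · simp only [consPerm_succ, Fin.succAbove_lt_succAbove_iff]
      exact h2 b c (by simp) (by simpa using hbc) (by simp at hc; omega)

/-- Removing the first entry `m`: if the new first entry is smaller, then a decreasing start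
loses one entry; otherwise the old start puts no condition on the rest. -/
lemma avoidsFrom_consPerm {k p n : ℕ} (hp : 0 < p) (hpk : p < k) (m : Fin (n + 2))
    (w : Equiv.Perm (Fin (n + 1))) :
    AvoidsFrom k (p + 1) (consPerm m w) ↔
      if (w 0 : ℕ) < m then AvoidsFrom k p w else AvoidsFrom k k w := by
  have hlt : (w 0).castSucc < m ↔ (w 0 : ℕ) < m := by rw [Fin.lt_def]; simp
  have hall : (∀ a, ¬ DescRun (consPerm m w) a k) ↔
      ¬ DescRun (consPerm m w) 0 k ∧ ∀ a, ¬ DescRun w a k := by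
    constructor
    · exact fun h => ⟨h 0, fun a ha => h (a + 1)
        ((descRun_consPerm_succ m w a k).2 ha)⟩
    · rintro ⟨h0, h1⟩ (_ | a)
      · exact h0
      · rw [descRun_consPerm_succ m w a k]; exact h1 a
  obtain ⟨q, rfl⟩ : ∃ q, k = q + 1 := ⟨k - 1, by omega⟩
  have hmono : DescRun w 0 q → DescRun w 0 p := fun h =>
    ⟨by have := h.1; omega, fun b c hb hbc hc => h.2 b c hb hbc (by omega)⟩
  unfold AvoidsFrom
  rw [hall, descRun_consPerm_zero m w p hp, descRun_consPerm_zero m w q (by omega), hlt]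
  split_ifs with h
  · simp only [h, true_and]
    tauto
  · simp only [h, false_and, not_false_eq_true, true_and]
    exact ⟨fun h' => ⟨h' 0, h'⟩, fun h' => h'.2⟩

open Classical in
/-- The number of `w ∈ S_n` with first entry `m` (0-based) that satisfy `AvoidsFrom k p`. -/
noncomputable def avoidFromCount (k p m n : ℕ) : ℕ :=
  Finset.card {w : Equiv.Perm (Fin n) | AvoidsFrom k p w ∧ ∃ h : 0 < n, (w ⟨0, h⟩ : ℕ) = m}

lemma avoidCountFirst_eq {k : ℕ} (hk : 0 < k) (m n : ℕ) :
    avoidCountFirst k (m + 1) n = avoidFromCount k k m n := by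
  classical
  unfold avoidCountFirst descentCountFirst avoidFromCount
  rw [Nat.card_eq_fintype_card, Fintype.card_subtype]
  congr 1
  ext w
  simp [kDescentSet_eq_empty_iff hk]

lemma avoidCount_succ_eq {k : ℕ} (hk : 0 < k) (n : ℕ) :
    avoidCount k (n + 1) = ∑ m ∈ Finset.range (n + 1), avoidFromCount k k m (n + 1) := by
  classical
  unfold avoidCount descentCount avoidFromCount
  rw [Nat.card_eq_fintype_card, Fintype.card_subtype]
  rw [Finset.card_eq_sum_card_fiberwise (f := fun w : Equiv.Perm (Fin (n + 1)) => (w 0 : ℕ))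
    (t := Finset.range (n + 1)) (by intro w _; simp; omega)]
  refine Finset.sum_congr rfl fun m _ => ?_
  rw [Finset.filter_filter]
  congr 1
  ext w
  simp [kDescentSet_eq_empty_iff hk]

lemma avoidCount_zero {k : ℕ} (hk : 0 < k) : avoidCount k 0 = 1 := by
  classical
  unfold avoidCount descentCount
  rw [Nat.card_eq_fintype_card, Fintype.card_subtype, Finset.filter_true_of_mem]
  · simp
  · intro w _
    rw [kDescentSet_eq_empty_iff hk]
    exact ⟨fun h => by have := h.1; omega, fun a h => by have := h.1; omega⟩

lemma avoidCount_pos {k : ℕ} (hk : 2 ≤ k) (n : ℕ) : 0 < avoidCount k n := by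
  unfold avoidCount descentCount
  have : Nonempty {w : Equiv.Perm (Fin n) // kDescentSet k w = ∅} := by
    refine ⟨1, ?_⟩
    rw [Set.eq_empty_iff_forall_notMem]
    rintro i ⟨a, -, h1, h2⟩
    have := h2 a ⟨a + 1, by omega⟩ le_rfl (by simp [Fin.lt_def]) (by simp; omega)
    simp [Fin.lt_def] at this
  exact Nat.card_pos

lemma avoidFromCount_succ {k p n : ℕ} (hp : 0 < p) (hpk : p < k) {m : ℕ} (hm : m ≤ n + 1) :
    avoidFromCount k (p + 1) m (n + 2) = ∑ m' ∈ Finset.range (n + 1),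
      if m' < m then avoidFromCount k p m' (n + 1) else avoidFromCount k k m' (n + 1) := by
  classical
  have h1 : avoidFromCount k (p + 1) m (n + 2) = Finset.card {w : Equiv.Perm (Fin (n + 1)) |
      if (w 0 : ℕ) < m then AvoidsFrom k p w else AvoidsFrom k k w} := by
    unfold avoidFromCount
    symm
    refine Finset.card_bij (fun w _ => consPerm ⟨m, by omega⟩ w) ?_ ?_ ?_
    · intro w hw
      simp only [Finset.mem_filter, Finset.mem_univ, true_and] at hw ⊢
      refine ⟨(avoidsFrom_consPerm hp hpk _ w).2 hw, by omega, ?_⟩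
      exact congrArg Fin.val (consPerm_zero _ w)
    · intro w _ w' _ h
      exact consPerm_injective _ h
    · intro v hv
      simp only [Finset.mem_filter, Finset.mem_univ, true_and] at hv
      obtain ⟨hv, hpos, hv0⟩ := hv
      obtain ⟨w, hw⟩ := exists_consPerm v
      have h0 : v 0 = ⟨m, by omega⟩ := Fin.ext hv0
      rw [h0] at hw
      refine ⟨w, ?_, hw⟩
      simp only [Finset.mem_filter, Finset.mem_univ, true_and]
      rw [← hw] at hv
      exact (avoidsFrom_consPerm hp hpk _ w).1 hv
  rw [h1, Finset.card_eq_sum_card_fiberwise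
    (f := fun w : Equiv.Perm (Fin (n + 1)) => (w 0 : ℕ))
    (t := Finset.range (n + 1)) (by intro w _; simp; omega)]
  refine Finset.sum_congr rfl fun m' _ => ?_
  rw [Finset.filter_filter]
  unfold avoidFromCount
  rw [← apply_ite Finset.card]
  congr 1
  ext w
  split_ifs with h
  · simp only [Finset.mem_filter, Finset.mem_univ, true_and]
    constructor
    · rintro ⟨h2, rfl⟩; rw [if_pos h] at h2; exact ⟨h2, by omega, rfl⟩
    · rintro ⟨h2, h0, rfl⟩; exact ⟨(if_pos h).symm ▸ h2, rfl⟩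
  · simp only [Finset.mem_filter, Finset.mem_univ, true_and]
    constructor
    · rintro ⟨h2, rfl⟩; rw [if_neg h] at h2; exact ⟨h2, by omega, rfl⟩
    · rintro ⟨h2, h0, rfl⟩; exact ⟨(if_neg h).symm ▸ h2, rfl⟩

/-- The coefficients of the expansion of `avoidFromCount k p`: they are `1` at the multiples of
`k`, `-1` at the numbers congruent to `p - 1` modulo `k`, and `0` elsewhere (for `p = 1` the two
contributions cancel). The second condition is written as `k ∣ l + (k + 1 - p)`, where `p ≤ k`. -/
def runSign (k p l : ℕ) : ℝ :=
  (if k ∣ l then 1 else 0) - (if k ∣ l + (k + 1 - p) then 1 else 0)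

lemma runSign_self {k : ℕ} (hk : 2 ≤ k) (l : ℕ) : runSign k k l = seriesSign k l := by
  unfold runSign seriesSign
  rw [Nat.add_sub_cancel_left]
  have : ¬ (k ∣ l ∧ k ∣ l + 1) := by
    rintro ⟨h1, h2⟩
    have := (Nat.dvd_add_right h1).1 h2
    have := Nat.le_of_dvd one_pos this
    omega
  by_cases h1 : k ∣ l <;> by_cases h2 : k ∣ l + 1 <;> simp_all

lemma runSign_one (k l : ℕ) : runSign k 1 l = 0 := by
  simp [runSign]

lemma runSign_succ_zero {k p : ℕ} (hp : 0 < p) (hpk : p < k) : runSign k (p + 1) 0 = 1 := by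
  unfold runSign
  have : ¬ k ∣ 0 + (k + 1 - (p + 1)) := fun h => by
    have := Nat.le_of_dvd (by omega) h
    omega
  simp only [this]
  simp

lemma runSign_succ_succ {k p : ℕ} (hpk : p < k) (l : ℕ) :
    runSign k (p + 1) (l + 1) = runSign k p l - runSign k k l := by
  unfold runSign
  have h1 : l + 1 + (k + 1 - (p + 1)) = l + (k + 1 - p) := by omega
  have h2 : l + (k + 1 - k) = l + 1 := by omega
  rw [h1, h2]
  ring

lemma sum_range_choose_succ (m l : ℕ) :
    ∑ i ∈ Finset.range m, (i.choose l : ℝ) = m.choose (l + 1) := by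
  induction m with
  | zero => simp
  | succ m ih => rw [Finset.sum_range_succ, ih, Nat.choose_succ_succ]; push_cast; ring

/-- The number of choices for a decreasing start `m > w (1) > ⋯ > w (l)` followed by an arbitrary
permutation without `k`-descents is `m.choose l * avoidCount k (n - l)`; the count is an alternating
sum of these. -/
theorem avoidFromCount_eq_sum {k : ℕ} (hk : 2 ≤ k) (n : ℕ) : ∀ p m : ℕ, 0 < p → p ≤ k → m ≤ n →
    (avoidFromCount k p m (n + 1) : ℝ) =
      ∑ l ∈ Finset.range (m + 1), runSign k p l * (m.choose l * avoidCount k (n - l)) := by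
  have one : ∀ n m, avoidFromCount k 1 m (n + 1) = 0 := by
    intro n m
    classical
    unfold avoidFromCount
    rw [Finset.card_eq_zero, Finset.filter_eq_empty_iff]
    rintro w - ⟨⟨h, -⟩, -⟩
    exact h ⟨by omega, fun b c _ hbc hc => by rw [Fin.lt_def] at hbc; omega⟩
  induction n with
  | zero =>
    intro p m hp hpk hm
    obtain rfl : m = 0 := by omega
    obtain ⟨p, rfl⟩ : ∃ q, p = q + 1 := ⟨p - 1, by omega⟩
    rcases Nat.eq_zero_or_pos p with rfl | hp0
    · simp [one, runSign_one]
    · have : avoidFromCount k (p + 1) 0 1 = 1 := by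
        classical
        unfold avoidFromCount
        rw [Finset.filter_true_of_mem]
        · simp
        · intro w _
          exact ⟨⟨fun h => by have := h.1; omega, fun a h => by have := h.1; omega⟩, by simp⟩
      simp [this, runSign_succ_zero hp0 (show p < k by omega), avoidCount_zero (show 0 < k by omega)]
  | succ n ih =>
    intro p m hp hpk hm
    obtain ⟨p, rfl⟩ : ∃ q, p = q + 1 := ⟨p - 1, by omega⟩
    rcases Nat.eq_zero_or_pos p with rfl | hp0
    · simp [one, runSign_one]
    have hpk' : p < k := by omega
    have split : (avoidFromCount k (p + 1) m (n + 2) : ℝ) = avoidCount k (n + 1) +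
        ∑ m' ∈ Finset.range m,
          ((avoidFromCount k p m' (n + 1) : ℝ) - avoidFromCount k k m' (n + 1)) := by
      rw [avoidFromCount_succ hp0 hpk' hm, avoidCount_succ_eq (by omega)]
      have hsub : Finset.range m ⊆ Finset.range (n + 1) := Finset.range_mono hm
      have : ∑ m' ∈ Finset.range m,
          ((avoidFromCount k p m' (n + 1) : ℝ) - avoidFromCount k k m' (n + 1)) =
          ∑ m' ∈ Finset.range (n + 1), if m' < m then
            ((avoidFromCount k p m' (n + 1) : ℝ) - avoidFromCount k k m' (n + 1)) else 0 := by
        rw [← Finset.sum_filter]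
        refine Finset.sum_congr ?_ fun _ _ => rfl
        ext i; simp; omega
      rw [this]
      push_cast
      rw [← Finset.sum_add_distrib]
      refine Finset.sum_congr rfl fun m' _ => ?_
      split_ifs <;> simp
    rw [split, Finset.sum_range_succ', runSign_succ_zero hp0 hpk']
    have inner : ∀ m' ∈ Finset.range m,
        ((avoidFromCount k p m' (n + 1) : ℝ) - avoidFromCount k k m' (n + 1)) =
        ∑ l ∈ Finset.range m,
          runSign k (p + 1) (l + 1) * (m'.choose l * avoidCount k (n - l)) := by
      intro m' hm'
      rw [Finset.mem_range] at hm'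
      rw [ih p m' hp0 hpk'.le (by omega), ih k m' (by omega) le_rfl (by omega),
        ← Finset.sum_sub_distrib]
      rw [← Finset.sum_subset (Finset.range_mono (show m' + 1 ≤ m by omega))]
      · refine Finset.sum_congr rfl fun l _ => ?_
        rw [runSign_succ_succ hpk']
        ring
      · intro l _ hl
        rw [Finset.mem_range] at hl
        rw [Nat.choose_eq_zero_of_lt (by omega)]
        simp
    rw [Finset.sum_congr rfl inner, Finset.sum_comm, add_comm]
    congr 1
    · refine Finset.sum_congr rfl fun l _ => ?_
      rw [← Finset.mul_sum, ← Finset.sum_mul]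
      rw [sum_range_choose_succ, Nat.succ_sub_succ]
    · simp

/-- Entries are 0-based here: this counts the `w ∈ S_{n+1}` with first entry `m + 1`. -/
theorem avoidCountFirst_eq_sum {k : ℕ} (hk : 2 ≤ k) {m n : ℕ} (hm : m ≤ n) :
    (avoidCountFirst k (m + 1) (n + 1) : ℝ) =
      ∑ l ∈ Finset.range (m + 1), seriesSign k l * (m.choose l * avoidCount k (n - l)) := by
  rw [avoidCountFirst_eq (by omega), avoidFromCount_eq_sum hk n k m (by omega) le_rfl hm]
  simp only [runSign_self hk]

/-- Summing over the first entry. -/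
theorem avoidCount_succ_eq_sum {k : ℕ} (hk : 2 ≤ k) (n : ℕ) :
    (avoidCount k (n + 1) : ℝ) = ∑ l ∈ Finset.range (n + 1),
      seriesSign k l * ((n + 1).choose (l + 1) * avoidCount k (n - l)) := by
  rw [avoidCount_succ_eq (by omega)]
  push_cast
  have inner : ∀ m ∈ Finset.range (n + 1), (avoidFromCount k k m (n + 1) : ℝ) =
      ∑ l ∈ Finset.range (n + 1), seriesSign k l * (m.choose l * avoidCount k (n - l)) := by
    intro m hm
    rw [Finset.mem_range] at hm
    rw [← avoidCountFirst_eq (by omega), avoidCountFirst_eq_sum hk (by omega)]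
    refine Finset.sum_subset (Finset.range_mono (show m + 1 ≤ n + 1 by omega)) ?_
    intro l _ hl
    rw [Finset.mem_range] at hl
    rw [Nat.choose_eq_zero_of_lt (by omega)]
    simp
  rw [Finset.sum_congr rfl inner, Finset.sum_comm]
  refine Finset.sum_congr rfl fun l _ => ?_
  rw [← Finset.mul_sum, ← Finset.sum_mul]
  rw [sum_range_choose_succ]

/-! ### Power series with one dominant zero -/

open Finset in
/-- If `x` is a summable nonnegative sequence and `∑ (i - 1) x i` (over `i ≥ 1`) converges, then it
bounds the sums of the tails `∑ i > n, x i` over `n ≥ 1`. -/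
lemma sum_tails_le {x : ℕ → ℝ} (hx : ∀ i, 0 ≤ x i) (hs : Summable x)
    (hs' : Summable fun i : ℕ => (i : ℝ) * x (i + 1)) (N : ℕ) :
    ∑ n ∈ range N, ∑' i, (if n + 1 < i then x i else 0) ≤ ∑' i : ℕ, (i : ℝ) * x (i + 1) := by
  have hsum : ∀ n, Summable fun i => if n + 1 < i then x i else 0 := fun n =>
    Summable.of_nonneg_of_le (fun i => by split_ifs <;> simp [hx])
      (fun i => by split_ifs <;> simp [hx]) hs
  have hcard : ∀ i, ∑ n ∈ range N, (if n + 1 < i + 1 then x (i + 1) else 0) ≤ i * x (i + 1) := by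
    intro i
    rw [← sum_filter, sum_const, nsmul_eq_mul]
    refine mul_le_mul_of_nonneg_right ?_ (hx _)
    have : filter (fun n => n + 1 < i + 1) (range N) ⊆ range i := by
      intro n hn
      simp only [mem_filter, mem_range] at hn ⊢
      omega
    exact_mod_cast (card_le_card this).trans_eq (card_range i)
  have hF : Summable fun i => ∑ n ∈ range N, if n + 1 < i then x i else 0 :=
    summable_sum fun n _ => hsum n
  have h0 : ∑ n ∈ range N, (if n + 1 < 0 then x 0 else 0) = 0 :=
    sum_eq_zero fun n _ => if_neg (Nat.not_lt_zero _)
  rw [← Summable.tsum_finsetSum (fun n _ => hsum n), hF.tsum_eq_zero_add, h0, zero_add]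
  exact ((summable_nat_add_iff 1).2 hF).tsum_le_tsum hcard hs'

open PowerSeries in
/-- Let `D(z) = ∑ d n z ^ n` with `d 0 = 1` have a zero at `ρ ∈ (0, R)`, and suppose that
`∑ (i - 1) |d i| R ^ i < 1`. Then the coefficients `a n ≥ 0` of `1 / D(z)` satisfy
`a n * ρ ^ n = c + O((ρ / R) ^ n)` with `c > 0`.

After the rescaling `z ↦ ρ z` the quotient of `D` by `1 - z` has as its coefficients the partial
sums `s n` of `D(ρ) = 0`, which are also the negatives of the tails. The hypothesis makes
`∑ n ≥ 1, |s n| (R / ρ) ^ n` less than `1`, so the inverse of that quotient has coefficients of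
size at most `(ρ / R) ^ n`. -/
theorem exists_abs_mul_pow_sub_le {a d : ℕ → ℝ} {ρ R : ℝ} (ha : ∀ n, 0 ≤ a n) (hd0 : d 0 = 1)
    (had : mk a * mk d = 1) (hρ : 0 < ρ) (hρR : ρ < R)
    (hdR : Summable fun i => |d i| * R ^ i) (hzero : ∑' i, d i * ρ ^ i = 0)
    (hdR' : Summable fun i : ℕ => (i : ℝ) * (|d (i + 1)| * R ^ (i + 1)))
    (hlt : ∑' i : ℕ, (i : ℝ) * (|d (i + 1)| * R ^ (i + 1)) < 1) :
    ∃ c K : ℝ, 0 < c ∧ ∀ n, |a n * ρ ^ n - c| ≤ K * (ρ / R) ^ n := by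
  have hR : 0 < R := hρ.trans hρR
  set t := ρ / R with ht
  have ht0 : 0 < t := div_pos hρ hR
  have ht1 : t < 1 := (div_lt_one hR).2 hρR
  have hdρ : Summable fun i => d i * ρ ^ i := by
    refine Summable.of_norm_bounded hdR fun i => ?_
    rw [Real.norm_eq_abs, abs_mul, abs_of_pos (pow_pos hρ i)]
    gcongr
  let s : ℕ → ℝ := fun n => ∑ i ∈ Finset.range (n + 1), d i * ρ ^ i
  let α : ℕ → ℝ := fun n => a n * ρ ^ n
  let b : ℕ → ℝ := fun n => α n - if n = 0 then 0 else α (n - 1)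
  have hs0 : s 0 = 1 := by simp [s, hd0]
  have hαb : ∀ n, α n = ∑ i ∈ Finset.range (n + 1), b i := by
    intro n
    induction n with
    | zero => simp [b]
    | succ n ih => rw [Finset.sum_range_succ, ← ih]; simp [b]
  have hs1 : mk s * (1 - X) = mk fun n => d n * ρ ^ n := by
    ext n
    cases n with
    | zero => simp [s, mul_sub]
    | succ n => simp [s, mul_sub, coeff_succ_mul_X, Finset.sum_range_succ _ (n + 1)]
  have hb1 : mk α * (1 - X) = mk b := by
    ext n
    cases n with
    | zero => simp [b, mul_sub]
    | succ n => simp [b, mul_sub, coeff_succ_mul_X]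
  have hαd : mk α * (mk fun n => d n * ρ ^ n) = 1 := by
    have h := congrArg (rescale ρ) had
    rw [map_mul, map_one, rescale_mk, rescale_mk] at h
    convert h using 3
    · ext n; simp [α, mul_comm]
    · ext n; simp [mul_comm]
  have hsb : mk s * mk b = 1 := by
    rw [← hb1, mul_left_comm, hs1, hαd]
  -- The coefficients of the quotient are small in the weighted norm.
  have hstail : ∀ n, |s n| * t⁻¹ ^ n ≤ ∑' i, if n < i then |d i| * R ^ i else 0 := by
    intro n
    have h1 : s n = - ∑' i, if n < i then d i * ρ ^ i else 0 := by
      have hsplit := hdρ.sum_add_tsum_nat_add (n + 1)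
      have hs' : Summable fun i => if n < i then d i * ρ ^ i else 0 := by
        refine Summable.of_norm_bounded hdρ.norm fun i => ?_
        split_ifs
        · exact le_rfl
        · rw [norm_zero]; exact norm_nonneg _
      have h2 := hs'.sum_add_tsum_nat_add (n + 1)
      rw [Finset.sum_eq_zero (fun i hi => if_neg (by have := Finset.mem_range.1 hi; omega))] at h2
      rw [← h2, zero_add]
      have h3 : ∀ i, (if n < i + (n + 1) then d (i + (n + 1)) * ρ ^ (i + (n + 1)) else 0) =
          d (i + (n + 1)) * ρ ^ (i + (n + 1)) := fun i => if_pos (by omega)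
      simp only [h3]
      rw [hzero] at hsplit
      linarith
    have hsR : Summable fun i => if n < i then |d i| * R ^ i else 0 := by
      refine Summable.of_nonneg_of_le (fun i => ?_) (fun i => ?_) hdR
      · split_ifs <;> positivity
      · split_ifs
        · exact le_rfl
        · positivity
    rw [h1, abs_neg, ← Real.norm_eq_abs]
    rw [← le_div_iff₀ (by positivity), div_eq_mul_inv, ← inv_pow, inv_inv]
    rw [← tsum_mul_right]
    refine tsum_of_norm_bounded (hsR.mul_right _).hasSum fun i => ?_
    split_ifs with hi
    · rw [Real.norm_eq_abs, abs_mul, abs_of_pos (pow_pos hρ i), mul_assoc]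
      refine mul_le_mul_of_nonneg_left ?_ (abs_nonneg _)
      have : R ^ i * t ^ i = ρ ^ i := by rw [← mul_pow, ht, mul_div_cancel₀ _ hR.ne']
      rw [← this]
      exact mul_le_mul_of_nonneg_left (pow_le_pow_of_le_one ht0.le ht1.le hi.le) (by positivity)
    · simp
  have hsN : ∀ N, ∑ n ∈ Finset.range N, |s (n + 1)| * t⁻¹ ^ (n + 1) ≤ 1 := fun N =>
    (Finset.sum_le_sum fun n _ => hstail (n + 1)).trans
      ((sum_tails_le (fun i => by positivity) hdR hdR' N).trans hlt.le)
  -- Hence so are those of its inverse.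
  have hbt : ∀ n, |b n| ≤ t ^ n := by
    intro n
    induction n using Nat.strong_induction_on with
    | _ n ih =>
      have hn := congrArg (coeff n) hsb
      rw [coeff_mul, Finset.Nat.sum_antidiagonal_eq_sum_range_succ_mk] at hn
      simp only [coeff_mk] at hn
      rw [Finset.sum_range_succ', hs0, one_mul, Nat.sub_zero] at hn
      rcases Nat.eq_zero_or_pos n with rfl | hpos
      · simp at hn
        simp [hn]
      rw [coeff_one, if_neg hpos.ne'] at hn
      have : b n = - ∑ i ∈ Finset.range n, s (i + 1) * b (n - (i + 1)) := by linarith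
      rw [this, abs_neg]
      calc |∑ i ∈ Finset.range n, s (i + 1) * b (n - (i + 1))|
          ≤ ∑ i ∈ Finset.range n, |s (i + 1) * b (n - (i + 1))| := Finset.abs_sum_le_sum_abs _ _
        _ ≤ ∑ i ∈ Finset.range n, (|s (i + 1)| * t⁻¹ ^ (i + 1)) * t ^ n := by
            refine Finset.sum_le_sum fun i hi => ?_
            rw [Finset.mem_range] at hi
            rw [abs_mul, mul_assoc]
            refine mul_le_mul_of_nonneg_left ((ih _ (by omega)).trans_eq ?_) (abs_nonneg _)
            rw [inv_pow, pow_sub₀ _ ht0.ne' (by omega), mul_comm]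
        _ ≤ t ^ n := by
            rw [← Finset.sum_mul]
            exact mul_le_of_le_one_left (by positivity) (hsN n)
  have hgeo := summable_geometric_of_lt_one ht0.le ht1
  have hbn : Summable fun n => ‖b n‖ := Summable.of_nonneg_of_le (fun _ => norm_nonneg _) hbt hgeo
  have hbs : Summable b := hbn.of_norm
  have hsn : Summable fun n => ‖s n‖ := by
    rw [← summable_nat_add_iff 1]
    refine summable_of_sum_range_le (c := 1) (fun _ => norm_nonneg _) fun N =>
      (Finset.sum_le_sum fun n _ => ?_).trans (hsN N)
    exact le_mul_of_one_le_right (abs_nonneg _) (one_le_pow₀ ((one_le_inv₀ ht0).2 ht1.le))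
  have hlim : ∀ n, |α n - ∑' i, b i| ≤ (t / (1 - t)) * t ^ n := by
    intro n
    rw [hαb, ← hbs.sum_add_tsum_nat_add (n + 1), sub_add_cancel_left, abs_neg, ← Real.norm_eq_abs]
    have h := (hgeo.mul_right (t ^ (n + 1))).hasSum
    rw [tsum_mul_right, tsum_geometric_of_lt_one ht0.le ht1] at h
    refine (tsum_of_norm_bounded h fun i => ?_).trans_eq ?_
    · rw [← pow_add]; exact hbt _
    · rw [pow_succ]; ring
  have hprod : (∑' n, s n) * ∑' n, b n = 1 := by
    rw [tsum_mul_tsum_eq_tsum_sum_antidiagonal_of_summable_norm hsn hbn]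
    have : ∀ n, ∑ p ∈ Finset.HasAntidiagonal.antidiagonal n, s p.1 * b p.2 = if n = 0 then 1 else 0 := by
      intro n
      have hn := congrArg (coeff n) hsb
      simpa only [coeff_mul, coeff_one, coeff_mk] using hn
    simp only [this, tsum_ite_eq]
  refine ⟨∑' n, b n, t / (1 - t), lt_of_le_of_ne ?_ ?_, hlim⟩
  · refine ge_of_tendsto' (?_ : Filter.Tendsto α Filter.atTop (nhds _)) fun n =>
      mul_nonneg (ha n) (pow_nonneg hρ.le n)
    rw [tendsto_iff_norm_sub_tendsto_zero]
    refine squeeze_zero (fun _ => norm_nonneg _) hlim ?_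
    simpa using (tendsto_pow_atTop_nhds_zero_of_lt_one ht0.le ht1).const_mul (t / (1 - t))
  · intro h
    rw [← h, mul_zero] at hprod
    exact zero_ne_one hprod

/-! ### The dominant zero of the denominator -/

lemma abs_seriesSign_le (k l : ℕ) : |seriesSign k l| ≤ 1 := by
  unfold seriesSign
  split_ifs <;> simp

lemma seriesSign_zero (k : ℕ) : seriesSign k 0 = 1 := by simp [seriesSign]

lemma seriesSign_eq_zero {k l : ℕ} (h0 : 0 < l) (h : l + 1 < k) : seriesSign k l = 0 := by
  unfold seriesSign
  rw [if_neg (fun hd => by have := Nat.le_of_dvd h0 hd; omega),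
    if_neg (fun hd => by have := Nat.le_of_dvd (by omega) hd; omega)]

/-- The coefficients of the reciprocal `D(z) = 1 - z + z ^ k / k! - z ^ (k + 1) / (k + 1)! + ⋯` of
the exponential generating function of `avoidCount k`. -/
noncomputable def denomCoeff (k : ℕ) : ℕ → ℝ
  | 0 => 1
  | l + 1 => - (seriesSign k l / ((l + 1).factorial : ℝ))

lemma mk_avoidCount_mul_mk_denomCoeff {k : ℕ} (hk : 2 ≤ k) :
    PowerSeries.mk (fun n => (avoidCount k n : ℝ) / n.factorial) *
      PowerSeries.mk (denomCoeff k) = 1 := by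
  rw [mul_comm]
  ext n
  rw [PowerSeries.coeff_mul, Finset.Nat.sum_antidiagonal_eq_sum_range_succ_mk,
    PowerSeries.coeff_one]
  simp only [PowerSeries.coeff_mk]
  rw [Finset.sum_range_succ']
  cases n with
  | zero => simp [denomCoeff, avoidCount_zero (show 0 < k by omega)]
  | succ n =>
    simp only [denomCoeff, Nat.sub_zero, one_mul, Nat.succ_ne_zero, if_false]
    rw [avoidCount_succ_eq_sum hk, Finset.sum_div, ← Finset.sum_add_distrib]
    refine Finset.sum_eq_zero fun l hl => ?_
    rw [Finset.mem_range] at hl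
    rw [Nat.cast_choose ℝ (show l + 1 ≤ n + 1 by omega), Nat.succ_sub_succ]
    have h1 : ((n + 1).factorial : ℝ) ≠ 0 := by positivity
    have h2 : ((n - l).factorial : ℝ) ≠ 0 := by positivity
    have h3 : ((l + 1).factorial : ℝ) ≠ 0 := by positivity
    field_simp
    ring

lemma abs_denomCoeff_le (k i : ℕ) : |denomCoeff k i| ≤ 1 / (i.factorial : ℝ) := by
  cases i with
  | zero => simp [denomCoeff]
  | succ l =>
    rw [denomCoeff, abs_neg, abs_div, abs_of_pos (show (0 : ℝ) < (l + 1).factorial by positivity)]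
    gcongr
    exact abs_seriesSign_le k l

lemma abs_denomCoeff_mul_pow_le (k i : ℕ) {R : ℝ} (hR : 0 ≤ R) :
    |denomCoeff k i| * R ^ i ≤ R ^ i / (i.factorial : ℝ) := by
  rw [div_eq_inv_mul, ← one_div]
  gcongr
  exact abs_denomCoeff_le k i

lemma denomCoeff_mul_pow_le (k i : ℕ) {R : ℝ} (hR : 0 ≤ R) :
    denomCoeff k i * R ^ i ≤ R ^ i / (i.factorial : ℝ) :=
  (mul_le_mul_of_nonneg_right (le_abs_self _) (pow_nonneg hR i)).trans
    (abs_denomCoeff_mul_pow_le k i hR)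

lemma summable_abs_denomCoeff (k : ℕ) {R : ℝ} (hR : 0 ≤ R) :
    Summable fun i => |denomCoeff k i| * R ^ i :=
  Summable.of_nonneg_of_le (fun i => by positivity) (fun i => abs_denomCoeff_mul_pow_le k i hR)
    (Real.summable_pow_div_factorial R)

lemma exp_five_quarters_lt : Real.exp (5 / 4) < 7 / 2 := by
  have h : Real.exp (5 / 4) ^ 4 = Real.exp 1 ^ 5 := by
    rw [← Real.exp_nat_mul, ← Real.exp_nat_mul]; norm_num
  refine lt_of_pow_lt_pow_left₀ 4 (by norm_num) ?_
  rw [h]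
  calc Real.exp 1 ^ 5 < 2.7182818286 ^ 5 :=
        pow_lt_pow_left₀ Real.exp_one_lt_d9 (Real.exp_pos _).le (by norm_num)
    _ < (7 / 2) ^ 4 := by norm_num

lemma hasSum_pow_div_factorial (x : ℝ) :
    HasSum (fun n : ℕ => x ^ n / (n.factorial : ℝ)) (Real.exp x) := by
  rw [Real.exp_eq_exp_ℝ]
  exact NormedSpace.expSeries_div_hasSum_exp x

lemma hasSum_nat_mul_pow_succ_div_factorial (x : ℝ) :
    HasSum (fun n : ℕ => (n : ℝ) * (x ^ (n + 1) / ((n + 1).factorial : ℝ)))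
      ((x - 1) * Real.exp x + 1) := by
  have h1 := (hasSum_pow_div_factorial x).mul_left x
  have h2 : HasSum (fun n : ℕ => x ^ (n + 1) / ((n + 1).factorial : ℝ)) (Real.exp x - 1) := by
    simpa using (hasSum_nat_add_iff' 1).2 (hasSum_pow_div_factorial x)
  have hf : (fun n : ℕ => (n : ℝ) * (x ^ (n + 1) / ((n + 1).factorial : ℝ))) =
      fun n : ℕ => x * (x ^ n / (n.factorial : ℝ)) - x ^ (n + 1) / ((n + 1).factorial : ℝ) := by
    ext n
    have h3 : ((n + 1).factorial : ℝ) = (n + 1) * n.factorial := by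
      rw [Nat.factorial_succ]; push_cast; ring
    have h4 : (n.factorial : ℝ) ≠ 0 := by positivity
    rw [h3, pow_succ]
    field_simp
    ring
  rw [hf, show (x - 1) * Real.exp x + 1 = x * Real.exp x - (Real.exp x - 1) by ring]
  exact h1.sub h2

/-- The vanishing signs at small places for `k = 3` and for `k ≥ 4` leave a sum less than `1`. -/
lemma tsum_denomCoeff_lt_one {k : ℕ} (hk : 3 ≤ k) :
    (Summable fun i : ℕ => (i : ℝ) * (|denomCoeff k (i + 1)| * (5 / 4) ^ (i + 1))) ∧
    ∑' i : ℕ, (i : ℝ) * (|denomCoeff k (i + 1)| * (5 / 4) ^ (i + 1)) < 1 := by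
  set j : ℕ := if k = 3 then 4 else 2 with hj
  have hj0 : seriesSign k j = 0 := by
    rcases eq_or_lt_of_le hk with rfl | h
    · simp only [hj, if_true]; unfold seriesSign; norm_num
    · rw [hj, if_neg (by omega)]; exact seriesSign_eq_zero (by norm_num) (by omega)
  have hbound : ∀ i : ℕ, (i : ℝ) * (|denomCoeff k (i + 1)| * (5 / 4) ^ (i + 1)) ≤
      (i : ℝ) * ((5 / 4) ^ (i + 1) / ((i + 1).factorial : ℝ)) -
        (if i = 1 then (25 / 32 : ℝ) else 0) - (if i = j then (625 / 6144 : ℝ) else 0) := by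
    intro i
    by_cases h1 : i = 1
    · subst h1
      have : (1 : ℕ) ≠ j := by rw [hj]; split_ifs <;> norm_num
      rw [if_neg this]
      simp only [denomCoeff, seriesSign_eq_zero one_pos (show 1 + 1 < k by omega)]
      norm_num [Nat.factorial]
    by_cases h2 : i = j
    · rw [if_neg h1, if_pos h2, h2]
      simp only [denomCoeff, hj0]
      rw [hj]
      split_ifs <;> norm_num [Nat.factorial]
    · rw [if_neg h1, if_neg h2, sub_zero, sub_zero]
      gcongr
      exact abs_denomCoeff_mul_pow_le k _ (by norm_num)
  have hsum := ((hasSum_nat_mul_pow_succ_div_factorial (5 / 4)).sub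
    (hasSum_ite_eq (1 : ℕ) (25 / 32 : ℝ))).sub (hasSum_ite_eq j (625 / 6144 : ℝ))
  have hs := Summable.of_nonneg_of_le (fun i => by positivity) hbound hsum.summable
  refine ⟨hs, (hasSum_le hbound hs.hasSum hsum).trans_lt ?_⟩
  have := exp_five_quarters_lt
  linarith

lemma tsum_denomCoeff_five_quarters_neg {k : ℕ} (hk : 3 ≤ k) :
    ∑' i, denomCoeff k i * (5 / 4) ^ i < 0 := by
  have hs : Summable fun i => denomCoeff k i * (5 / 4 : ℝ) ^ i := by
    refine Summable.of_norm_bounded (summable_abs_denomCoeff k (R := 5 / 4) (by norm_num))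
      fun i => ?_
    rw [norm_mul, Real.norm_eq_abs, norm_pow, Real.norm_of_nonneg (by norm_num : (0 : ℝ) ≤ 5 / 4)]
  set j : ℕ := if k = 3 then 4 else 3 with hj
  set v : ℝ := if k = 3 then 625 / 3072 else 125 / 384 with hv
  have hjv : denomCoeff k j * (5 / 4) ^ j = (5 / 4) ^ j / (j.factorial : ℝ) - v := by
    rcases eq_or_lt_of_le hk with rfl | h
    · simp only [hj, hv, if_true, denomCoeff]; unfold seriesSign; norm_num [Nat.factorial]
    · rw [hj, hv, if_neg (by omega), if_neg (by omega), denomCoeff,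
        seriesSign_eq_zero (by norm_num) (by omega)]
      norm_num [Nat.factorial]
  set w : ℝ := if k = 3 then 625 / 24576 else 0 with hw
  have hw5 : denomCoeff k 5 * (5 / 4) ^ 5 ≤ (5 / 4) ^ 5 / ((5 : ℕ).factorial : ℝ) - w := by
    rcases eq_or_lt_of_le hk with rfl | h
    · simp only [hw, if_true, denomCoeff]; unfold seriesSign; norm_num [Nat.factorial]
    · rw [hw, if_neg (by omega), sub_zero]
      exact denomCoeff_mul_pow_le k _ (by norm_num)
  have hbound : ∀ i : ℕ, denomCoeff k i * (5 / 4) ^ i ≤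
      (5 / 4) ^ i / (i.factorial : ℝ) - (if i = 1 then (5 / 2 : ℝ) else 0) -
        (if i = 2 then (25 / 32 : ℝ) else 0) - (if i = j then v else 0) -
        (if i = 5 then w else 0) := by
    intro i
    have hj' : j = 3 ∨ j = 4 := by rw [hj]; split_ifs <;> simp
    by_cases h1 : i = 1
    · subst h1
      rw [if_neg (show (1 : ℕ) ≠ j by omega)]
      simp only [denomCoeff, seriesSign_zero]
      norm_num [Nat.factorial]
    by_cases h2 : i = 2
    · subst h2
      rw [if_neg (show (2 : ℕ) ≠ j by omega)]
      simp only [denomCoeff, seriesSign_eq_zero one_pos (show 1 + 1 < k by omega)]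
      norm_num [Nat.factorial]
    by_cases h3 : i = j
    · rw [if_neg h1, if_neg h2, if_pos h3, if_neg (by omega), h3, hjv]
      simp
    by_cases h5 : i = 5
    · rw [if_neg h1, if_neg h2, if_neg h3, if_pos h5, h5]
      simpa using hw5
    · rw [if_neg h1, if_neg h2, if_neg h3, if_neg h5]
      simp only [sub_zero]
      exact denomCoeff_mul_pow_le k _ (by norm_num)
  have hsum := ((((hasSum_pow_div_factorial (5 / 4)).sub
    (hasSum_ite_eq (1 : ℕ) (5 / 2 : ℝ))).sub (hasSum_ite_eq (2 : ℕ) (25 / 32 : ℝ))).sub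
    (hasSum_ite_eq j v)).sub (hasSum_ite_eq (5 : ℕ) w)
  refine (hasSum_le hbound hs.hasSum hsum).trans_lt ?_
  have := exp_five_quarters_lt
  rw [hv, hw]
  split_ifs <;> linarith

lemma exists_denom_zero {k : ℕ} (hk : 3 ≤ k) :
    ∃ ρ : ℝ, 0 < ρ ∧ ρ < 5 / 4 ∧ ∑' i, denomCoeff k i * ρ ^ i = 0 := by
  have hcont : ContinuousOn (fun x : ℝ => ∑' i, denomCoeff k i * x ^ i) (Set.Icc 0 (5 / 4)) := by
    refine continuousOn_tsum (fun i => by fun_prop)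
      (summable_abs_denomCoeff k (R := 5 / 4) (by norm_num)) fun i x hx => ?_
    rw [norm_mul, Real.norm_eq_abs, norm_pow, Real.norm_of_nonneg hx.1]
    have := hx.1
    gcongr
    exact hx.2
  have h0 : ∑' i, denomCoeff k i * (0 : ℝ) ^ i = 1 := by
    rw [tsum_eq_single 0 fun i hi => by simp [hi]]
    simp [denomCoeff]
  have hneg := tsum_denomCoeff_five_quarters_neg hk
  obtain ⟨ρ, ⟨h1, h2⟩, h3⟩ := intermediate_value_Icc' (by norm_num) hcont
    (show (0 : ℝ) ∈ Set.Icc _ _ from ⟨hneg.le, by rw [h0]; exact zero_le_one⟩)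
  have h3 : ∑' i, denomCoeff k i * ρ ^ i = 0 := h3
  refine ⟨ρ, lt_of_le_of_ne h1 ?_, lt_of_le_of_ne h2 ?_, h3⟩
  · rintro rfl
    rw [h0] at h3
    exact one_ne_zero h3
  · rintro rfl
    exact hneg.ne h3

/-- The zero of the denominator governs the numbers `avoidCount k n`. -/
theorem exists_avoidCount_asymptotics {k : ℕ} (hk : 3 ≤ k) :
    ∃ ρ c K : ℝ, 0 < ρ ∧ ρ < 5 / 4 ∧ 0 < c ∧
      ∀ n, |(avoidCount k n : ℝ) / n.factorial * ρ ^ n - c| ≤ K * (ρ / (5 / 4)) ^ n := by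
  obtain ⟨ρ, h0, h1, h2⟩ := exists_denom_zero hk
  obtain ⟨hs, hlt⟩ := tsum_denomCoeff_lt_one hk
  obtain ⟨c, K, hc, h⟩ := exists_abs_mul_pow_sub_le
    (a := fun n => (avoidCount k n : ℝ) / n.factorial) (fun n => by positivity) rfl
    (mk_avoidCount_mul_mk_denomCoeff (by omega)) h0 h1
    (summable_abs_denomCoeff k (by norm_num)) h2 hs hlt
  exact ⟨ρ, c, K, h0, h1, hc, h⟩

/-- The series of `firstEntryDensity` stays away from `0` where it is needed. -/
lemma one_tenth_le_tsum {k : ℕ} (hk : 3 ≤ k) {y : ℝ} (hy0 : 0 ≤ y) (hy : y ≤ 5 / 4) :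
    1 / 10 ≤ ∑' l : ℕ, seriesSign k l * (y ^ l / (l.factorial : ℝ)) := by
  have hs : Summable fun l : ℕ => seriesSign k l * (y ^ l / (l.factorial : ℝ)) := by
    simpa using summable_firstEntryDensity k 1 y
  set j : ℕ := if k = 3 then 3 else 2 with hj
  set v : ℝ := if k = 3 then 125 / 384 else 25 / 32 with hv
  have hjv : -((5 / 4) ^ j / (j.factorial : ℝ)) + v ≤ seriesSign k j * (y ^ j / j.factorial) := by
    rcases eq_or_lt_of_le hk with rfl | h
    · simp only [hj, hv, if_true]
      unfold seriesSign
      norm_num [Nat.factorial]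
      positivity
    · rw [hj, hv, if_neg (by omega), if_neg (by omega), seriesSign_eq_zero (by norm_num) (by omega)]
      norm_num [Nat.factorial]
  have hgen : ∀ l : ℕ, -((5 / 4 : ℝ) ^ l / (l.factorial : ℝ)) ≤
      seriesSign k l * (y ^ l / l.factorial) := by
    intro l
    refine (abs_le.1 ?_).1
    rw [abs_mul, abs_of_nonneg (show 0 ≤ y ^ l / (l.factorial : ℝ) by positivity)]
    refine (mul_le_of_le_one_left (by positivity) (abs_seriesSign_le k l)).trans ?_
    gcongr
  have hw4 : -((5 / 4 : ℝ) ^ 4 / ((4 : ℕ).factorial : ℝ)) + (if k = 3 then 625 / 6144 else 0) ≤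
      seriesSign k 4 * (y ^ 4 / ((4 : ℕ).factorial : ℝ)) := by
    split_ifs with h
    · subst h
      unfold seriesSign
      norm_num [Nat.factorial]
    · rw [add_zero]; exact hgen 4
  set w : ℝ := if k = 3 then 625 / 6144 else 0 with hw
  have hbound : ∀ l : ℕ, -((5 / 4 : ℝ) ^ l / (l.factorial : ℝ)) + (if l = 0 then (2 : ℝ) else 0) +
      (if l = 1 then (5 / 4 : ℝ) else 0) + (if l = j then v else 0) + (if l = 4 then w else 0) ≤
      seriesSign k l * (y ^ l / l.factorial) := by
    intro l
    have hj' : j = 2 ∨ j = 3 := by rw [hj]; split_ifs <;> simp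
    by_cases h0 : l = 0
    · subst h0
      rw [if_neg (show (0 : ℕ) ≠ j by omega), seriesSign_zero]
      norm_num
    by_cases h1 : l = 1
    · subst h1
      rw [if_neg (show (1 : ℕ) ≠ j by omega), seriesSign_eq_zero one_pos (show 1 + 1 < k by omega)]
      norm_num
    by_cases h2 : l = j
    · rw [if_neg h0, if_neg h1, if_pos h2, if_neg (by omega), h2]
      simpa using hjv
    by_cases h4 : l = 4
    · rw [if_neg h0, if_neg h1, if_neg h2, if_pos h4, h4]
      simpa using hw4
    · rw [if_neg h0, if_neg h1, if_neg h2, if_neg h4]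
      simpa using hgen l
  have hsum := ((((hasSum_pow_div_factorial (5 / 4)).neg.add
    (hasSum_ite_eq (0 : ℕ) (2 : ℝ))).add (hasSum_ite_eq (1 : ℕ) (5 / 4 : ℝ))).add
    (hasSum_ite_eq j v)).add (hasSum_ite_eq (4 : ℕ) w)
  refine le_trans ?_ (hasSum_le hbound hsum hs.hasSum)
  have := exp_five_quarters_lt
  rw [hv, hw]
  split_ifs <;> linarith

/-! ### The density of the first entry -/

lemma firstEntryDensity_one_div (k : ℕ) (ρ x : ℝ) :
    firstEntryDensity k (1 / ρ) x =
      ρ * ∑' l : ℕ, seriesSign k l * ((x * ρ) ^ l / (l.factorial : ℝ)) := by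
  unfold firstEntryDensity
  simp only [one_div, div_inv_eq_mul, one_mul]

lemma summable_seriesSign_mul (k : ℕ) (y : ℝ) :
    Summable fun l : ℕ => seriesSign k l * (y ^ l / (l.factorial : ℝ)) := by
  simpa using summable_firstEntryDensity k 1 y

lemma summable_sq_mul_pow_div_factorial {ρ : ℝ} (hρ : 0 ≤ ρ) :
    Summable fun l : ℕ => ρ ^ l / (l.factorial : ℝ) * (l : ℝ) ^ 2 := by
  refine Summable.of_nonneg_of_le (fun l => by positivity) (fun l => ?_)
    (Real.summable_pow_div_factorial (4 * ρ))
  have h : (l : ℝ) ^ 2 ≤ 4 ^ l := by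
    have : (l : ℝ) ≤ 2 ^ l := by exact_mod_cast (Nat.lt_two_pow_self (n := l)).le
    calc (l : ℝ) ^ 2 ≤ (2 ^ l) ^ 2 := by gcongr
      _ = 4 ^ l := by rw [← pow_mul, mul_comm, pow_mul]; norm_num
  rw [mul_pow, mul_div_assoc, mul_comm]
  gcongr

lemma descFactorial_div_le_one {m n : ℕ} (h : m ≤ n) (l : ℕ) :
    (m.descFactorial l : ℝ) / n.descFactorial l ≤ 1 :=
  div_le_one_of_le₀ (by exact_mod_cast Nat.descFactorial_le l h) (by positivity)

/-- Each factor `(m - i) / (n - i)` of the quotient of falling factorials differs from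
`(m + 1) / (n + 1)` by at most `(i + 1) / (n + 1)`. -/
lemma abs_descFactorial_div_sub_pow_le {m n : ℕ} (h : m ≤ n) (l : ℕ) :
    |(m.descFactorial l : ℝ) / n.descFactorial l - (((m : ℝ) + 1) / (n + 1)) ^ l| ≤
      (l : ℝ) ^ 2 / (n + 1) := by
  set y : ℝ := ((m : ℝ) + 1) / (n + 1) with hy
  have hy0 : 0 ≤ y := by positivity
  have hmn : (m : ℝ) ≤ n := by exact_mod_cast h
  have hy1 : y ≤ 1 := div_le_one_of_le₀ (by linarith) (by positivity)
  rcases lt_or_ge m l with hl | hl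
  · rw [Nat.descFactorial_eq_zero_iff_lt.2 hl, Nat.cast_zero, zero_div, zero_sub, abs_neg,
      abs_of_nonneg (by positivity)]
    have hl' : (m : ℝ) + 1 ≤ l := by exact_mod_cast hl
    calc y ^ l ≤ y := pow_le_of_le_one hy0 hy1 (by omega)
      _ ≤ (l : ℝ) ^ 2 / (n + 1) := by
        rw [hy]
        gcongr
        have : (0 : ℝ) ≤ m := by positivity
        nlinarith
  · induction l with
    | zero => simp
    | succ l ih =>
      have ih := ih (by omega)
      have hlm : (l : ℝ) + 1 ≤ m := by exact_mod_cast hl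
      have hnl : (0 : ℝ) < n - l := by linarith
      have hP0 : (0 : ℝ) ≤ (m.descFactorial l : ℝ) / n.descFactorial l := by positivity
      have hP1 := descFactorial_div_le_one h l
      have hstep : ((m.descFactorial (l + 1) : ℕ) : ℝ) / n.descFactorial (l + 1) =
          (((m : ℝ) - l) / (n - l)) * ((m.descFactorial l : ℝ) / n.descFactorial l) := by
        rw [Nat.descFactorial_succ, Nat.descFactorial_succ, Nat.cast_mul, Nat.cast_mul,
          Nat.cast_sub (by omega), Nat.cast_sub (by omega), mul_div_mul_comm]
      have hdiff : y - ((m : ℝ) - l) / (n - l) = (n - m) * (1 + l) / ((n + 1) * (n - l)) := by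
        rw [hy, div_sub_div _ _ (by positivity) hnl.ne']
        congr 1
        ring
      have hd0 : 0 ≤ y - ((m : ℝ) - l) / (n - l) := by
        rw [hdiff]
        have : (0 : ℝ) ≤ n - m := by linarith
        positivity
      have hd1 : y - ((m : ℝ) - l) / (n - l) ≤ (l + 1) / (n + 1) := by
        rw [hdiff, div_le_div_iff₀ (by positivity) (by positivity)]
        have : ((n : ℝ) - m) ≤ n - l := by linarith
        have h2 : (0 : ℝ) ≤ (1 + l) * (n + 1) := by positivity
        nlinarith [mul_le_mul_of_nonneg_left this h2]
      rw [hstep]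
      set P := (m.descFactorial l : ℝ) / n.descFactorial l with hP
      set q := ((m : ℝ) - l) / (n - l) with hq
      calc |q * P - y ^ (l + 1)| = |y * (P - y ^ l) - (y - q) * P| := by
            congr 1; ring
        _ ≤ |y * (P - y ^ l)| + |(y - q) * P| := abs_sub _ _
        _ ≤ 1 * ((l : ℝ) ^ 2 / (n + 1)) + ((l + 1) / (n + 1)) * 1 := by
            rw [abs_mul, abs_mul, abs_of_nonneg hy0, abs_of_nonneg hd0, abs_of_nonneg hP0]
            gcongr
        _ = ((l : ℝ) ^ 2 + (l + 1)) / (n + 1) := by ring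
        _ ≤ (((l + 1 : ℕ) : ℝ)) ^ 2 / (n + 1) := by
            gcongr
            push_cast
            nlinarith [(Nat.cast_nonneg l : (0 : ℝ) ≤ l)]

/-- The normalized number of permutations with first entry `m + 1`, as a perturbation of the series
for the density. -/
lemma mul_avoidCountFirst_div_eq_tsum {k : ℕ} (hk : 2 ≤ k) {ρ : ℝ} (hρ : 0 < ρ) {m n : ℕ}
    (hm : m ≤ n) :
    ((n : ℝ) + 1) * avoidCountFirst k (m + 1) (n + 1) / avoidCount k (n + 1) =
      ρ * ∑' l : ℕ, seriesSign k l * (ρ ^ l / (l.factorial : ℝ) *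
        ((m.descFactorial l : ℝ) / n.descFactorial l *
          (((avoidCount k (n - l) : ℝ) / (n - l).factorial * ρ ^ (n - l)) /
            ((avoidCount k (n + 1) : ℝ) / (n + 1).factorial * ρ ^ (n + 1))))) := by
  rw [tsum_eq_sum (s := Finset.range (m + 1)), avoidCountFirst_eq_sum hk hm, Finset.mul_sum,
    Finset.sum_div, Finset.mul_sum]
  · refine Finset.sum_congr rfl fun l hl => ?_
    rw [Finset.mem_range] at hl
    have hln : l ≤ n := by omega
    have hf : (avoidCount k (n + 1) : ℝ) ≠ 0 := by exact_mod_cast (avoidCount_pos hk _).ne'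
    have h1 : ((n + 1).factorial : ℝ) = (n + 1) * n.factorial := by
      rw [Nat.factorial_succ]; push_cast; ring
    have h2 : (n.factorial : ℝ) = n.descFactorial l * (n - l).factorial := by
      rw [← Nat.factorial_mul_descFactorial hln]; push_cast; ring
    have h3 : (m.descFactorial l : ℝ) = l.factorial * m.choose l := by
      exact_mod_cast Nat.descFactorial_eq_factorial_mul_choose m l
    have h4 : ρ ^ (n + 1) = ρ ^ (n - l) * ρ ^ l * ρ := by
      rw [← pow_add, ← pow_succ]; congr 1; omega
    have h5 : (n.descFactorial l : ℝ) ≠ 0 := by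
      rw [Nat.cast_ne_zero, Ne, Nat.descFactorial_eq_zero_iff_lt]
      omega
    have h6 : ((n - l).factorial : ℝ) ≠ 0 := by positivity
    have h7 : (l.factorial : ℝ) ≠ 0 := by positivity
    rw [h1, h2, h3, h4]
    field_simp
  · intro l hl
    rw [Finset.mem_range] at hl
    rw [Nat.descFactorial_eq_zero_iff_lt.2 (by omega)]
    simp

/-- The first entry has density `firstEntryDensity k (1 / ρ)` up to an error `O(1 / n)`. -/
theorem exists_abs_sub_firstEntryDensity_le {k : ℕ} (hk : 2 ≤ k) {ρ R c K : ℝ} (hρ : 0 < ρ)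
    (hρR : ρ < R) (hc : 0 < c)
    (h : ∀ n, |(avoidCount k n : ℝ) / n.factorial * ρ ^ n - c| ≤ K * (ρ / R) ^ n) :
    ∃ C : ℝ, 0 ≤ C ∧ ∀ m n : ℕ, m ≤ n →
      |((n : ℝ) + 1) * avoidCountFirst k (m + 1) (n + 1) / avoidCount k (n + 1) -
        firstEntryDensity k (1 / ρ) (((m : ℝ) + 1) / (n + 1))| ≤ C / (n + 1) := by
  have hR : 0 < R := hρ.trans hρR
  set t := ρ / R with ht
  have ht0 : 0 < t := div_pos hρ hR
  have ht1 : t < 1 := (div_lt_one hR).2 hρR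
  have hK : 0 ≤ K := by simpa using (abs_nonneg _).trans (h 0)
  set α : ℕ → ℝ := fun n => (avoidCount k n : ℝ) / n.factorial * ρ ^ n with hα
  have h : ∀ n, |α n - c| ≤ K * t ^ n := h
  have hαpos : ∀ n, 0 < α n := fun n => by
    have : (0 : ℝ) < avoidCount k n := by exact_mod_cast avoidCount_pos hk n
    positivity
  have hlim : Filter.Tendsto α Filter.atTop (nhds c) := by
    rw [tendsto_iff_norm_sub_tendsto_zero]
    refine squeeze_zero (fun _ => norm_nonneg _) h ?_
    simpa using (tendsto_pow_atTop_nhds_zero_of_lt_one ht0.le ht1).const_mul K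
  -- The numbers `α n` are bounded below, being positive with a positive limit.
  obtain ⟨B, hB⟩ := (hlim.inv₀ hc.ne').bddAbove_range
  have hB : ∀ n, (α n)⁻¹ ≤ B := fun n => hB ⟨n, rfl⟩
  have hB0 : 0 ≤ B := (inv_nonneg.2 (hαpos 0).le).trans (hB 0)
  obtain ⟨C₁, hC₁⟩ := ((tendsto_self_mul_const_pow_of_lt_one ht0.le ht1).add
    (tendsto_pow_atTop_nhds_zero_of_lt_one ht0.le ht1)).bddAbove_range
  have hC₁ : ∀ n : ℕ, t ^ n ≤ C₁ / (n + 1) := fun n => by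
    rw [le_div_iff₀ (by positivity)]
    have : (n : ℝ) * t ^ n + t ^ n ≤ C₁ := hC₁ ⟨n, rfl⟩
    linarith
  have hC₁0 : 0 ≤ C₁ := by
    have := hC₁ 0
    norm_num at this
    linarith
  set W : ℝ := ∑' l : ℕ, ρ ^ l / (l.factorial : ℝ) * (l : ℝ) ^ 2 with hW
  have hWs := summable_sq_mul_pow_div_factorial hρ.le
  have hW0 : 0 ≤ W := tsum_nonneg fun l => by positivity
  have hratio : ∀ l n, l ≤ n → |α (n - l) / α (n + 1) - 1| ≤ B * (2 * K * (t ^ n * t⁻¹ ^ l)) := by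
    intro l n hl
    have htl : t ^ n * t⁻¹ ^ l = t ^ (n - l) := by rw [pow_sub₀ _ ht0.ne' hl, inv_pow]
    have h1 : α (n - l) / α (n + 1) - 1 =
        (α (n + 1))⁻¹ * ((α (n - l) - c) - (α (n + 1) - c)) := by
      have := (hαpos (n + 1)).ne'
      field_simp
      ring
    rw [h1, abs_mul, abs_of_pos (inv_pos.2 (hαpos _)), htl]
    refine mul_le_mul (hB _) ?_ (abs_nonneg _) hB0
    have h2 : t ^ (n + 1) ≤ t ^ (n - l) := pow_le_pow_of_le_one ht0.le ht1.le (by omega)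
    calc |(α (n - l) - c) - (α (n + 1) - c)| ≤ |α (n - l) - c| + |α (n + 1) - c| := abs_sub _ _
      _ ≤ K * t ^ (n - l) + K * t ^ (n - l) :=
        add_le_add (h _) ((h _).trans (mul_le_mul_of_nonneg_left h2 hK))
      _ = 2 * K * t ^ (n - l) := by ring
  refine ⟨ρ * (2 * B * K * C₁ * Real.exp R + W), by positivity, fun m n hm => ?_⟩
  rw [mul_avoidCountFirst_div_eq_tsum hk hρ hm, firstEntryDensity_one_div, ← mul_sub, abs_mul,
    abs_of_pos hρ, mul_div_assoc]
  refine mul_le_mul_of_nonneg_left ?_ hρ.le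
  set y : ℝ := ((m : ℝ) + 1) / (n + 1) with hy
  rw [← Summable.tsum_sub (summable_of_ne_finset_zero (s := Finset.range (m + 1)) ?_)
    (summable_seriesSign_mul k _)]
  swap
  · intro l hl
    rw [Finset.mem_range] at hl
    rw [Nat.descFactorial_eq_zero_iff_lt.2 (by omega)]
    simp
  have hsum := ((hasSum_pow_div_factorial R).mul_left (2 * B * K * t ^ n)).add
    (hWs.hasSum.div_const ((n : ℝ) + 1))
  rw [← Real.norm_eq_abs]
  refine (tsum_of_norm_bounded hsum fun l => ?_).trans ?_
  · set P : ℝ := (m.descFactorial l : ℝ) / n.descFactorial l with hP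
    have hP0 : 0 ≤ P := by positivity
    have hP1 : P ≤ 1 := descFactorial_div_le_one hm l
    have hmain : |P * (α (n - l) / α (n + 1)) - y ^ l| ≤
        B * (2 * K * (t ^ n * t⁻¹ ^ l)) + (l : ℝ) ^ 2 / (n + 1) := by
      have h1 : P * (α (n - l) / α (n + 1)) - y ^ l =
          P * (α (n - l) / α (n + 1) - 1) + (P - y ^ l) := by ring
      rw [h1]
      refine (abs_add_le _ _).trans (add_le_add ?_ (abs_descFactorial_div_sub_pow_le hm l))
      rw [abs_mul, abs_of_nonneg hP0]
      rcases le_or_gt l n with hl | hl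
      · exact (mul_le_of_le_one_left (abs_nonneg _) hP1).trans (hratio l n hl)
      · rw [hP, Nat.descFactorial_eq_zero_iff_lt.2 (by omega : m < l)]
        simp only [Nat.cast_zero, zero_div, zero_mul]
        positivity
    have hR' : ρ ^ l * t⁻¹ ^ l = R ^ l := by
      rw [← mul_pow, ht, inv_div, mul_div_cancel₀ _ hρ.ne']
    rw [← mul_sub, mul_pow, Real.norm_eq_abs, abs_mul]
    refine (mul_le_of_le_one_left (abs_nonneg _) (abs_seriesSign_le k l)).trans ?_
    have h2 : ρ ^ l / (l.factorial : ℝ) * (P * (α (n - l) / α (n + 1))) -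
        y ^ l * ρ ^ l / (l.factorial : ℝ) =
        ρ ^ l / (l.factorial : ℝ) * (P * (α (n - l) / α (n + 1)) - y ^ l) := by ring
    calc _ = |ρ ^ l / (l.factorial : ℝ) * (P * (α (n - l) / α (n + 1)) - y ^ l)| := by rw [← h2]
      _ ≤ ρ ^ l / (l.factorial : ℝ) *
          (B * (2 * K * (t ^ n * t⁻¹ ^ l)) + (l : ℝ) ^ 2 / (n + 1)) := by
        rw [abs_mul, abs_of_nonneg (by positivity : (0 : ℝ) ≤ ρ ^ l / (l.factorial : ℝ))]
        gcongr
      _ = 2 * B * K * t ^ n * (ρ ^ l * t⁻¹ ^ l / (l.factorial : ℝ)) +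
          ρ ^ l / (l.factorial : ℝ) * (l : ℝ) ^ 2 / (n + 1) := by ring
      _ = _ := by rw [hR']
  · calc 2 * B * K * t ^ n * Real.exp R + W / (n + 1)
        ≤ 2 * B * K * (C₁ / (n + 1)) * Real.exp R + W / (n + 1) := by
          gcongr
          exact hC₁ n
      _ = (2 * B * K * C₁ * Real.exp R + W) / (n + 1) := by ring

lemma exists_lipschitz_firstEntryDensity (k : ℕ) {ρ : ℝ} (hρ : 0 < ρ) :
    ∃ L : ℝ, 0 ≤ L ∧ ∀ x ∈ Set.Icc (0 : ℝ) 1, ∀ y ∈ Set.Icc (0 : ℝ) 1,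
      |firstEntryDensity k (1 / ρ) x - firstEntryDensity k (1 / ρ) y| ≤ L * |x - y| := by
  have hWs := summable_sq_mul_pow_div_factorial hρ.le
  refine ⟨ρ * ∑' l : ℕ, ρ ^ l / (l.factorial : ℝ) * (l : ℝ) ^ 2,
    mul_nonneg hρ.le (tsum_nonneg fun l => by positivity), fun x hx y hy => ?_⟩
  rw [firstEntryDensity_one_div, firstEntryDensity_one_div, ← mul_sub, abs_mul, abs_of_pos hρ,
    mul_assoc]
  refine mul_le_mul_of_nonneg_left ?_ hρ.le
  rw [← (summable_seriesSign_mul k _).tsum_sub (summable_seriesSign_mul k _), ← Real.norm_eq_abs]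
  refine tsum_of_norm_bounded (hWs.hasSum.mul_right _) fun l => ?_
  have h1 : seriesSign k l * ((x * ρ) ^ l / (l.factorial : ℝ)) -
      seriesSign k l * ((y * ρ) ^ l / (l.factorial : ℝ)) =
      seriesSign k l * (ρ ^ l / (l.factorial : ℝ) * (x ^ l - y ^ l)) := by
    rw [mul_pow, mul_pow]; ring
  rw [h1, Real.norm_eq_abs, abs_mul]
  refine (mul_le_of_le_one_left (abs_nonneg _) (abs_seriesSign_le k l)).trans ?_
  rw [abs_mul, abs_of_nonneg (by positivity : (0 : ℝ) ≤ ρ ^ l / (l.factorial : ℝ)), mul_assoc]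
  refine mul_le_mul_of_nonneg_left ?_ (by positivity)
  refine (abs_pow_sub_pow_le x y l).trans ?_
  have h2 : max |x| |y| ^ (l - 1) ≤ 1 := by
    refine pow_le_one₀ (le_max_of_le_left (abs_nonneg _)) (max_le ?_ ?_)
    · rw [abs_of_nonneg hx.1]; exact hx.2
    · rw [abs_of_nonneg hy.1]; exact hy.2
  have h3 : (l : ℝ) ≤ (l : ℝ) ^ 2 := by exact_mod_cast Nat.le_self_pow two_ne_zero l
  calc |x - y| * l * max |x| |y| ^ (l - 1) ≤ |x - y| * (l : ℝ) ^ 2 * 1 := by gcongr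
    _ = (l : ℝ) ^ 2 * |x - y| := by ring

/-! ### Riemann sums -/

lemma intervalIntegrable_of_lipschitz {φ : ℝ → ℝ} {L : ℝ}
    (hφ : ∀ x ∈ Set.Icc (0 : ℝ) 1, ∀ y ∈ Set.Icc (0 : ℝ) 1, |φ x - φ y| ≤ L * |x - y|)
    {a b : ℝ} (ha : a ∈ Set.Icc (0 : ℝ) 1) (hb : b ∈ Set.Icc (0 : ℝ) 1) :
    IntervalIntegrable φ MeasureTheory.volume a b := by
  have hc : ContinuousOn φ (Set.Icc 0 1) :=
    (LipschitzOnWith.of_dist_le_mul (K := L.toNNReal) fun x hx y hy => by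
      rw [Real.dist_eq, Real.dist_eq]
      refine (hφ x hx y hy).trans ?_
      gcongr
      exact Real.le_coe_toNNReal L).continuousOn
  exact (hc.mono (Set.uIcc_subset_Icc ha hb)).intervalIntegrable

lemma abs_sum_sub_integral_le {φ : ℝ → ℝ} {L : ℝ}
    (hφ : ∀ x ∈ Set.Icc (0 : ℝ) 1, ∀ y ∈ Set.Icc (0 : ℝ) 1, |φ x - φ y| ≤ L * |x - y|)
    (hL : 0 ≤ L) {n : ℕ} (hn : 0 < n) {M : ℕ} (hM : M ≤ n) :
    |∑ m ∈ Finset.range M, φ (((m : ℝ) + 1) / n) / n - ∫ s in (0 : ℝ)..(M / n : ℝ), φ s| ≤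
      M * (L / n ^ 2) := by
  have hn' : (0 : ℝ) < n := by exact_mod_cast hn
  have hmem : ∀ m : ℕ, m ≤ n → (m / n : ℝ) ∈ Set.Icc (0 : ℝ) 1 := fun m hm =>
    ⟨by positivity, div_le_one_of_le₀ (by exact_mod_cast hm) hn'.le⟩
  induction M with
  | zero => simp
  | succ M ih =>
    have ih := ih (by omega)
    have h0 : (0 : ℝ) ∈ Set.Icc (0 : ℝ) 1 := ⟨le_rfl, zero_le_one⟩
    have hM0 := hmem M (by omega)
    have hM1 := hmem (M + 1) hM
    have hlen : ((M + 1 : ℕ) / n : ℝ) - M / n = 1 / n := by push_cast; ring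
    have hle : (M / n : ℝ) ≤ (M + 1 : ℕ) / n := by
      have : (0 : ℝ) ≤ 1 / n := by positivity
      linarith
    have hint := intervalIntegrable_of_lipschitz hφ hM0 hM1
    rw [Finset.sum_range_succ, ← intervalIntegral.integral_add_adjacent_intervals
      (intervalIntegrable_of_lipschitz hφ h0 hM0) hint]
    have hstep : |φ (((M : ℝ) + 1) / n) / n - ∫ s in (M / n : ℝ)..((M + 1 : ℕ) / n : ℝ), φ s| ≤
        L / n ^ 2 := by
      have h1 : φ (((M : ℝ) + 1) / n) / n - ∫ s in (M / n : ℝ)..((M + 1 : ℕ) / n : ℝ), φ s =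
          ∫ s in (M / n : ℝ)..((M + 1 : ℕ) / n : ℝ), (φ (((M : ℝ) + 1) / n) - φ s) := by
        rw [intervalIntegral.integral_sub (by simp) hint, intervalIntegral.integral_const, hlen,
          smul_eq_mul]
        ring
      rw [h1, ← Real.norm_eq_abs]
      refine (intervalIntegral.norm_integral_le_of_norm_le_const (C := L / n) fun s hs => ?_).trans
        (le_of_eq ?_)
      · rw [Set.uIoc_of_le hle] at hs
        have hs' : s ∈ Set.Icc (0 : ℝ) 1 := ⟨hM0.1.trans hs.1.le, hs.2.trans hM1.2⟩
        have hM1' : ((M : ℝ) + 1) / n ∈ Set.Icc (0 : ℝ) 1 := by exact_mod_cast hM1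
        refine (hφ _ hM1' s hs').trans ?_
        rw [div_eq_mul_one_div L]
        refine mul_le_mul_of_nonneg_left ?_ hL
        have h2 := hs.2
        push_cast at h2 hlen
        rw [abs_of_nonneg (by linarith)]
        linarith [hs.1]
      · rw [hlen, abs_of_pos (by positivity)]
        field_simp
    calc _ = |(∑ m ∈ Finset.range M, φ (((m : ℝ) + 1) / n) / n -
            ∫ s in (0 : ℝ)..(M / n : ℝ), φ s) +
          (φ (((M : ℝ) + 1) / n) / n - ∫ s in (M / n : ℝ)..((M + 1 : ℕ) / n : ℝ), φ s)| := by
          congr 1; ring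
      _ ≤ M * (L / n ^ 2) + L / n ^ 2 := (abs_add_le _ _).trans (add_le_add ih hstep)
      _ = _ := by push_cast; ring

/-- If `g m n` is within `C / n` of `φ (m / n)` for a Lipschitz function `φ`, then the sums of
`g m n / n` over `m ≤ x n` converge to the integral of `φ`. -/
lemma tendsto_sum_of_abs_sub_le {φ : ℝ → ℝ} {g : ℕ → ℕ → ℝ} {L C : ℝ}
    (hφ : ∀ x ∈ Set.Icc (0 : ℝ) 1, ∀ y ∈ Set.Icc (0 : ℝ) 1, |φ x - φ y| ≤ L * |x - y|)
    (hL : 0 ≤ L) (hC : 0 ≤ C)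
    (hg : ∀ m n : ℕ, m < n → |g (m + 1) n - φ (((m : ℝ) + 1) / n)| ≤ C / n)
    {x : ℝ} (hx0 : 0 ≤ x) (hx1 : x ≤ 1) :
    Filter.Tendsto (fun n : ℕ => ∑ m ∈ Finset.Icc 1 ⌊x * (n : ℝ)⌋₊, g m n / n)
      Filter.atTop (nhds (∫ t in (0 : ℝ)..x, φ t)) := by
  rw [tendsto_iff_norm_sub_tendsto_zero]
  refine squeeze_zero' (g := fun n : ℕ => (C + L + (|φ 0| + L)) / (n : ℝ))
    (Filter.Eventually.of_forall fun _ => norm_nonneg _) ?_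
    (tendsto_const_div_atTop_nhds_zero_nat _)
  filter_upwards [Filter.eventually_gt_atTop 0] with n hn
  have hn' : (0 : ℝ) < n := by exact_mod_cast hn
  set M := ⌊x * (n : ℝ)⌋₊ with hMdef
  have hMx : (M : ℝ) ≤ x * n := Nat.floor_le (by positivity)
  have hxM : x * n < M + 1 := Nat.lt_floor_add_one _
  have hMn' : (M : ℝ) ≤ n := hMx.trans (mul_le_of_le_one_left hn'.le hx1)
  have hMn : M ≤ n := by exact_mod_cast hMn'
  have hMle : (M / n : ℝ) ≤ x := (div_le_iff₀ hn').2 hMx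
  have hMmem : (M / n : ℝ) ∈ Set.Icc (0 : ℝ) 1 := ⟨by positivity, hMle.trans hx1⟩
  have h0mem : (0 : ℝ) ∈ Set.Icc (0 : ℝ) 1 := ⟨le_rfl, zero_le_one⟩
  have hre : ∑ m ∈ Finset.Icc 1 M, g m n / n = ∑ m ∈ Finset.range M, g (m + 1) n / n := by
    rw [Finset.range_eq_Ico, Finset.sum_Ico_add' (fun m => g m n / (n : ℝ)) 0 M 1]
    rfl
  have e1 : |∑ m ∈ Finset.range M, g (m + 1) n / n -
      ∑ m ∈ Finset.range M, φ (((m : ℝ) + 1) / n) / n| ≤ C / n := by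
    rw [← Finset.sum_sub_distrib]
    refine (Finset.abs_sum_le_sum_abs _ _).trans ?_
    calc _ ≤ ∑ m ∈ Finset.range M, C / n / (n : ℝ) := by
          refine Finset.sum_le_sum fun m hm => ?_
          rw [← sub_div, abs_div, abs_of_pos hn']
          gcongr
          exact hg m n (by have := Finset.mem_range.1 hm; omega)
      _ = M / n * (C / n) := by rw [Finset.sum_const, Finset.card_range, nsmul_eq_mul]; ring
      _ ≤ C / n := mul_le_of_le_one_left (by positivity) hMmem.2
  have e2 : |∑ m ∈ Finset.range M, φ (((m : ℝ) + 1) / n) / n -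
      ∫ s in (0 : ℝ)..(M / n : ℝ), φ s| ≤ L / n := by
    refine (abs_sum_sub_integral_le hφ hL hn hMn).trans ?_
    calc M * (L / n ^ 2) = M / n * (L / n) := by field_simp
      _ ≤ L / n := mul_le_of_le_one_left (by positivity) hMmem.2
  have e3 : |(∫ s in (0 : ℝ)..x, φ s) - ∫ s in (0 : ℝ)..(M / n : ℝ), φ s| ≤ (|φ 0| + L) / n := by
    rw [intervalIntegral.integral_interval_sub_left
      (intervalIntegrable_of_lipschitz hφ h0mem ⟨hx0, hx1⟩)
      (intervalIntegrable_of_lipschitz hφ h0mem hMmem), ← Real.norm_eq_abs]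
    refine (intervalIntegral.norm_integral_le_of_norm_le_const (C := |φ 0| + L)
      fun s hs => ?_).trans ?_
    · rw [Set.uIoc_of_le hMle] at hs
      have hs0 : 0 ≤ s := hMmem.1.trans hs.1.le
      have hs1 : s ≤ 1 := hs.2.trans hx1
      have h1 := hφ s ⟨hs0, hs1⟩ 0 h0mem
      rw [sub_zero, abs_of_nonneg hs0] at h1
      have h2 : L * s ≤ L := mul_le_of_le_one_right hL hs1
      have h3 : |φ s| ≤ |φ s - φ 0| + |φ 0| := by
        simpa using abs_add_le (φ s - φ 0) (φ 0)
      rw [Real.norm_eq_abs]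
      linarith
    · have h1 : x - M / n ≤ 1 / n := by
        rw [sub_le_iff_le_add, ← add_div, le_div_iff₀ hn']
        linarith
      rw [abs_of_nonneg (sub_nonneg.2 hMle)]
      exact (mul_le_mul_of_nonneg_left h1 (by positivity)).trans_eq (mul_one_div _ _)
  rw [hre, Real.norm_eq_abs]
  rw [abs_le] at e1 e2 e3 ⊢
  have hsplit : (C + L + (|φ 0| + L)) / (n : ℝ) = C / n + L / n + (|φ 0| + L) / n := by ring
  rw [hsplit]
  constructor <;> linarith [e1.1, e1.2, e2.1, e2.2, e3.1, e3.2]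

theorem theorem4p3 (k : ℕ) (hk : 3 ≤ k) :
    ∃ r : ℝ, IsGrowthConstant k r ∧
      (∃ C : ℝ, ∀ m n : ℕ, 1 ≤ m → m ≤ n →
        ∃ E : ℝ, |E| ≤ C * (n : ℝ) ^ (-(0.49 : ℝ)) ∧
          (n : ℝ) * (avoidCountFirst k m n : ℝ) / (avoidCount k n : ℝ) =
            firstEntryDensity k r ((m : ℝ) / (n : ℝ)) * (1 + E)) ∧
      ∀ x : ℝ, 0 ≤ x → x ≤ 1 →
        Filter.Tendsto
          (fun n : ℕ => (∑ m ∈ Finset.Icc 1 ⌊x * (n : ℝ)⌋₊, (avoidCountFirst k m n : ℝ)) /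
            (avoidCount k n : ℝ))
          Filter.atTop (nhds (∫ t in (0 : ℝ)..x, firstEntryDensity k r t)) := by
  have hk2 : 2 ≤ k := by omega
  obtain ⟨ρ, c, K, hρ, hρR, hc, h⟩ := exists_avoidCount_asymptotics hk
  obtain ⟨C, hC, hdens⟩ := exists_abs_sub_firstEntryDensity_le hk2 hρ hρR hc h
  have hdens' : ∀ m n : ℕ, m < n →
      |(n : ℝ) * avoidCountFirst k (m + 1) n / avoidCount k n -
        firstEntryDensity k (1 / ρ) (((m : ℝ) + 1) / n)| ≤ C / n := by
    intro m n hmn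
    obtain ⟨n, rfl⟩ : ∃ n', n = n' + 1 := ⟨n - 1, by omega⟩
    push_cast
    exact hdens m n (by omega)
  refine ⟨1 / ρ, ⟨by positivity, c, ρ / (5 / 4), K / c, hc, by positivity,
    (div_lt_one (by norm_num)).2 hρR, fun n _ => ?_⟩, ⟨10 * C / ρ, fun m n hm hmn => ?_⟩,
    fun x hx0 hx1 => ?_⟩
  · refine ⟨(avoidCount k n : ℝ) / n.factorial * ρ ^ n / c - 1, ?_, ?_⟩
    · have h1 : (avoidCount k n : ℝ) / n.factorial * ρ ^ n / c - 1 =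
          ((avoidCount k n : ℝ) / n.factorial * ρ ^ n - c) / c := by field_simp
      rw [h1, abs_div, abs_of_pos hc, div_mul_eq_mul_div K]
      exact div_le_div_of_nonneg_right (h n) hc.le
    · have : (n.factorial : ℝ) ≠ 0 := by positivity
      rw [one_div, inv_pow]
      field_simp
      ring
  · obtain ⟨m, rfl⟩ : ∃ m', m = m' + 1 := ⟨m - 1, by omega⟩
    have hn1 : (1 : ℝ) ≤ n := by exact_mod_cast (by omega : 1 ≤ n)
    have hn' : (0 : ℝ) < n := by linarith
    have hd := hdens' m n (by omega)
    have hφ : ρ / 10 ≤ firstEntryDensity k (1 / ρ) (((m : ℝ) + 1) / n) := by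
      have hx : ((m : ℝ) + 1) / n ≤ 1 := div_le_one_of_le₀ (by exact_mod_cast hmn) hn'.le
      have := one_tenth_le_tsum hk (y := ((m : ℝ) + 1) / n * ρ) (by positivity)
        ((mul_le_of_le_one_left hρ.le hx).trans hρR.le)
      rw [firstEntryDensity_one_div, div_eq_mul_one_div]
      exact mul_le_mul_of_nonneg_left this hρ.le
    push_cast
    set φ := firstEntryDensity k (1 / ρ) (((m : ℝ) + 1) / n)
    have hφ0 : 0 < φ := lt_of_lt_of_le (by positivity) hφ
    set A := (n : ℝ) * avoidCountFirst k (m + 1) n / avoidCount k n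
    refine ⟨A / φ - 1, ?_, by field_simp; ring⟩
    have h1 : A / φ - 1 = (A - φ) / φ := by field_simp
    rw [h1, abs_div, abs_of_pos hφ0]
    calc |A - φ| / φ ≤ (C / n) / (ρ / 10) := by gcongr
      _ = 10 * C / ρ * (n : ℝ) ^ (-1 : ℝ) := by rw [Real.rpow_neg_one]; field_simp
      _ ≤ 10 * C / ρ * (n : ℝ) ^ (-(0.49 : ℝ)) := by
        refine mul_le_mul_of_nonneg_left ?_ (by positivity)
        exact Real.rpow_le_rpow_of_exponent_le hn1 (by norm_num)
  · obtain ⟨L, hL, hlip⟩ := exists_lipschitz_firstEntryDensity k hρ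
    refine (tendsto_sum_of_abs_sub_le
      (g := fun m n => (n : ℝ) * avoidCountFirst k m n / avoidCount k n)
      hlip hL hC hdens' hx0 hx1).congr' ?_
    filter_upwards [Filter.eventually_gt_atTop 0] with n hn
    rw [Finset.sum_div]
    refine Finset.sum_congr rfl fun m _ => ?_
    have hn' : (n : ℝ) ≠ 0 := by exact_mod_cast hn.ne'
    field_simp
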